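/- Let $F(u)=\tfrac14(u^2-1)^2$, $f(u)=-F'(u)=u-u^3$ and $c_0=\sqrt2\,\big/\int_{-1}^1\sqrt{F(u)}\,du$. For $\delta\in\mathbb R$ let $m_+(\delta)$ and $m_-(\delta)$ be the largest and the smallest zero of $u\mapsto f(u)+\delta$, and let $c(\delta)$ denote the travelling wave speed, i.e. the unique $c\in\mathbb R$ (for those $\delta$, in particular those close to $0$, for which it exists and is unique) such that there is a strictly increasing $m\in C^2(\mathbb R)$ with $$m''+c\,m'+f(m)+\delta=0 \text{ on }\mathbb R,\qquad m(\pm\infty)=m_\pm(\delta).$$ Let $(W(t))_{t\ge0}$ and $(\widetilde W(t))_{t\ge 0}$ be independent standard Brownian motions on a probability space $(\Omega,\mathcal F,\mathbb P)$, and set $W(t)=\widetilde W(-t)$ for $t<0$. Let $\rho:\mathbb R\to[0,\infty)$ be smooth and symmetric, zero outside $[-1,1]$, with $\int\rho=1$; let $0<\gamma<\frac23$ and $1<\beta<2$, and for $\varepsilon>0$ put $$\rho^\varepsilon(x)=\varepsilon^{-\gamma}\rho(x/\varepsilon^{\gamma}),\qquad W^\varepsilon(t)=\int_{\mathbb R}\rho^\varepsilon(t-s)W(s)\,ds,\qquad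 \xi^\varepsilon(t)=\frac{d}{dt}W^\varepsilon(t).$$ Fix $T>0$ and let $$W^{\pm,\varepsilon}(t)=\frac1{c_0}\int_0^t\varepsilon^{-1}c\bigl(\varepsilon\xi^\varepsilon(s)\pm\varepsilon^\beta\bigr)\,ds,\qquad t\in[0,T].$$ Then, almost surely, for both choices of the sign, $W^{\pm,\varepsilon}$ is well defined on $[0,T]$ for all sufficiently small $\varepsilon>0$ (the threshold may depend on $\omega$): $W^\varepsilon$ is differentiable at each $s\in[0,T]$, the speed $c(\varepsilon\xi^\varepsilon(s)\pm\varepsilon^\beta)$ is defined for each $s\in[0,T]$, and the integrand is integrable on $[0,T]$. Moreover, almost surely, for both signs and for every $0\le\alpha<\frac12$, the functions $c_0W^{\pm,\varepsilon}$ converge, as $\varepsilon\downarrow0$, to $t\mapsto -c_0W(t)$ in $C^{0,\alpha}([0,T])$ (that is, in the norm $\|g\|_\infty+\sup_{s\ne t}|g(t)-g(s)|/|t-s|^\alpha$). -/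

import Mathlib

open MeasureTheory ProbabilityTheory Filter Set Topology
open scoped NNReal ENNReal

namespace AllenCahn

noncomputable section

/-! ### The potential, the reaction term and the travelling wave speed -/

/-- The symmetric double-well potential `F(u) = (u² - 1)² / 4`. -/
def potential (u : ℝ) : ℝ := (u ^ 2 - 1) ^ 2 / 4

/-- The reaction term `f = -F'`, i.e. `f(u) = u - u³`. -/
def reaction (u : ℝ) : ℝ := u - u ^ 3

theorem hasDerivAt_potential (u : ℝ) : HasDerivAt potential (-reaction u) u := by
  have h : HasDerivAt potential (2 * (u ^ 2 - 1) * (2 * u) / 4) u := by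
    have h1 : HasDerivAt (fun u : ℝ => u ^ 2 - 1) (2 * u) u := by
      simpa using (hasDerivAt_pow 2 u).sub_const 1
    have h2 := (h1.pow 2).div_const 4
    simp only [Nat.cast_ofNat, Nat.add_one_sub_one, pow_one] at h2
    exact h2
  convert h using 1
  unfold reaction
  ring

/-- The constant `c₀ = √2 / ∫_{-1}^{1} √(F(u)) du`. -/
def c₀ : ℝ := √2 / ∫ u in (-1 : ℝ)..1, √(potential u)

/-- The equilibrium `m₊(δ)`: the largest zero of `u ↦ f(u) + δ`. As long as this cubic has three
distinct zeros (`|δ| < 2 / (3√3)`) it is the smooth branch of zeros through `m₊(0) = 1`. -/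
def mPlus (δ : ℝ) : ℝ := sSup {u : ℝ | reaction u + δ = 0}

/-- The equilibrium `m₋(δ)`: the smallest zero of `u ↦ f(u) + δ`, the branch of zeros through
`m₋(0) = -1`. -/
def mMinus (δ : ℝ) : ℝ := sInf {u : ℝ | reaction u + δ = 0}

/-- `(m, c)` is an increasing travelling wave for the forcing `δ`: a classical solution of
`m'' + c m' + f(m) + δ = 0` on `ℝ` with `m(±∞) = m_±(δ)`. -/
structure IsTravellingWave (δ c : ℝ) (m : ℝ → ℝ) : Prop where
  contDiff : ContDiff ℝ 2 m
  strictMono : StrictMono m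
  ode : ∀ x, deriv (deriv m) x + c * deriv m x + (reaction (m x) + δ) = 0
  tendsto_atTop : Tendsto m atTop (𝓝 (mPlus δ))
  tendsto_atBot : Tendsto m atBot (𝓝 (mMinus δ))

/-- `δ` is admissible when there is exactly one speed `c` of an increasing travelling wave, i.e.
when the wave speed `c(δ)` is well defined. -/
def HasWaveSpeed (δ : ℝ) : Prop := ∃! c : ℝ, ∃ m : ℝ → ℝ, IsTravellingWave δ c m

/-- The travelling wave speed `c(δ)` (meaningful for admissible `δ`, see `HasWaveSpeed`). -/
def waveSpeed (δ : ℝ) : ℝ :=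
  Classical.epsilon fun c : ℝ => ∃ m : ℝ → ℝ, IsTravellingWave δ c m

/-! ### The approximated noise -/

/-- A mollifying kernel: smooth, nonnegative, symmetric, zero outside `[-1, 1]`, of integral 1. -/
structure IsMollifier (ρ : ℝ → ℝ) : Prop where
  smooth : ContDiff ℝ ((⊤ : ℕ∞) : WithTop ℕ∞) ρ
  nonneg : ∀ x, 0 ≤ ρ x
  symm : ∀ x, ρ (-x) = ρ x
  eq_zero : ∀ x, x ∉ Icc (-1 : ℝ) 1 → ρ x = 0
  integral_eq_one : ∫ x, ρ x = 1

/-- The two-sided path which is `b` on `[0, ∞)` and `t ↦ b' (-t)` on `(-∞, 0)`. -/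
def twoSided (b b' : ℝ≥0 → ℝ) (t : ℝ) : ℝ :=
  if 0 ≤ t then b t.toNNReal else b' (-t).toNNReal

/-- The rescaled kernel `ρ^ε(x) = ε^{-γ} ρ(x / ε^γ)`. -/
def scaledKernel (ρ : ℝ → ℝ) (γ ε x : ℝ) : ℝ := ε ^ (-γ) * ρ (x / ε ^ γ)

/-- The mollified path `w^ε(t) = ∫ ρ^ε(t - s) w(s) ds`. -/
def mollified (ρ : ℝ → ℝ) (γ : ℝ) (w : ℝ → ℝ) (ε t : ℝ) : ℝ :=
  ∫ s, scaledKernel ρ γ ε (t - s) * w s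

/-- The noise `ξ^ε`, the time derivative of the mollified path. -/
def noise (ρ : ℝ → ℝ) (γ : ℝ) (w : ℝ → ℝ) (ε t : ℝ) : ℝ := deriv (mollified ρ γ w ε) t

/-- The perturbed argument `ε ξ^ε(s) + σ ε^β` of the wave speed, with sign `σ = ±1`. -/
def forcing (ρ : ℝ → ℝ) (γ β σ : ℝ) (w : ℝ → ℝ) (ε s : ℝ) : ℝ :=
  ε * noise ρ γ w ε s + σ * ε ^ β

/-- `W^{±,ε}(t) = c₀⁻¹ ∫_0^t ε⁻¹ c(ε ξ^ε(s) ± ε^β) ds`, with sign `σ = ±1`. -/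
def Wpm (ρ : ℝ → ℝ) (γ β σ : ℝ) (w : ℝ → ℝ) (ε t : ℝ) : ℝ :=
  1 / c₀ * ∫ s in (0 : ℝ)..t, ε⁻¹ * waveSpeed (forcing ρ γ β σ w ε s)

/-! ### Convergence in Hölder spaces -/

/-- The norm `sup |g| + sup_{s ≠ t} |g(t) - g(s)| / |t - s|^α` of `C^{0,α}([0,T])`, with value `∞`
for functions outside this space. -/
def holderENorm (T : ℝ) (α : ℝ≥0) (g : ℝ → ℝ) : ℝ≥0∞ :=
  (⨆ t : Icc (0 : ℝ) T, ‖g t‖ₑ) + eHolderNorm α (fun t : Icc (0 : ℝ) T => g t)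

/-- `u ε → v` in `C^{0,α}([0,T])` as `ε ↓ 0`: the limit and, for small `ε`, the functions `u ε`
belong to `C^{0,α}([0,T])`, and the norm of the difference tends to `0`. -/
def TendstoHolder (T : ℝ) (α : ℝ≥0) (u : ℝ → ℝ → ℝ) (v : ℝ → ℝ) : Prop :=
  holderENorm T α v < ∞ ∧ (∀ᶠ ε in 𝓝[>] (0 : ℝ), holderENorm T α (u ε) < ∞) ∧
    Tendsto (fun ε => holderENorm T α (fun t => u ε t - v t)) (𝓝[>] 0) (𝓝 0)

end

end AllenCahn

namespace AllenCahn

/-! For a cubic the travelling wave is explicit. If `a < b < d` are the zeros of `f + δ`, the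
logistic profile from `a` to `d` is a wave of speed `√2 (b - (a + d) / 2)`. The zeros of `u - u³ +
δ` sum to zero and `c₀ = 3 / √2`, so this speed is `c₀ b`. An integrating factor shows that no other
speed is possible (`IsTravellingWave.speed_eq`). Since `b - b³ = -δ`, it follows that `c(δ) + c₀ δ =
c₀ b³`, which is of order `|δ|³` (`abs_waveSpeed_add_le`).

The rest of the convergence argument is pathwise. Boundedness of the path gives `ε ξ^ε = O(ε^(1-γ))`
on `[0, T]`, so after division by `ε` the cubic remainder is `O(ε^(2-3γ))`, which vanishes because
`γ < 2/3`; the shift `±ε^β` contributes `O(ε^(β-1))`. The linear part integrates to `-c₀` times an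
increment of the mollified path. If the path is `α'`-Hölder with `α' > α`, its mollification error
is small in the `α`-Hölder seminorm (`abs_mollified_sub_sub_le`). Together this is
`tendstoHolder_Wpm`.

Probability enters only through the Hölder regularity of Brownian paths of every order below `1/2`,
proved by Gaussian moments, Borel–Cantelli and dyadic chaining (`ae_exists_holder`). -/

theorem c₀_eq : c₀ = 3 / √2 := by
  have h : ∫ u in (-1 : ℝ)..1, √(potential u) = ∫ u in (-1 : ℝ)..1, (1 - u ^ 2) / 2 := by
    refine intervalIntegral.integral_congr fun u hu => ?_
    rw [uIcc_of_le (by norm_num)] at hu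
    have h1 : potential u = ((1 - u ^ 2) / 2) ^ 2 := by unfold potential; ring
    simp only [h1]
    exact Real.sqrt_sq (by nlinarith [hu.1, hu.2])
  have h2 : ∫ u in (-1 : ℝ)..1, (1 - u ^ 2) / 2 = 2 / 3 := by
    simp only [intervalIntegral.integral_div]
    rw [intervalIntegral.integral_sub (by simp) (by simp)]
    norm_num [integral_pow]
  rw [c₀, h, h2]
  have h3 : √2 * √2 = 2 := Real.mul_self_sqrt (by norm_num)
  have h4 : √2 ≠ 0 := by positivity
  field_simp
  linarith

theorem c₀_pos : 0 < c₀ := by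
  rw [c₀_eq]; positivity

/-! ### Explicit travelling waves and uniqueness of the speed. -/

section Wave

variable {δ a b d : ℝ}

theorem setOf_reaction_add_eq_zero
    (hfac : ∀ u, reaction u + δ = (u - a) * (d - u) * (u - b)) :
    {u : ℝ | reaction u + δ = 0} = {a, b, d} := by
  ext u
  simp only [mem_ofPred_eq, hfac, mul_eq_zero, sub_eq_zero, mem_insert_iff, mem_singleton_iff]
  constructor
  · rintro ((h | h) | h)
    exacts [Or.inl h, Or.inr (Or.inr h.symm), Or.inr (Or.inl h)]
  · rintro (h | h | h)
    exacts [Or.inl (Or.inl h), Or.inr h, Or.inl (Or.inr h.symm)]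

theorem mPlus_eq (hab : a < b) (hbd : b < d)
    (hfac : ∀ u, reaction u + δ = (u - a) * (d - u) * (u - b)) : mPlus δ = d := by
  rw [mPlus, setOf_reaction_add_eq_zero hfac]
  refine IsGreatest.csSup_eq ⟨by simp, ?_⟩
  rintro u (rfl | rfl | rfl) <;> linarith

theorem mMinus_eq (hab : a < b) (hbd : b < d)
    (hfac : ∀ u, reaction u + δ = (u - a) * (d - u) * (u - b)) : mMinus δ = a := by
  rw [mMinus, setOf_reaction_add_eq_zero hfac]
  refine IsLeast.csInf_eq ⟨by simp, ?_⟩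
  rintro u (rfl | rfl | rfl) <;> linarith

/-- The logistic profile of the travelling wave connecting `a` to `d`. -/
noncomputable def waveProfile (a d x : ℝ) : ℝ := a + (d - a) * Real.sigmoid ((d - a) / √2 * x)

/-- The factor `1 / √2` makes the second derivative cancel the cubic term of the reaction, leaving a
condition on the speed alone. -/
theorem hasDerivAt_waveProfile (a d x : ℝ) :
    HasDerivAt (waveProfile a d)
      ((waveProfile a d x - a) * (d - waveProfile a d x) / √2) x := by
  have h1 : HasDerivAt (fun x : ℝ => (d - a) / √2 * x) ((d - a) / √2) x := by
    simpa using (hasDerivAt_id x).const_mul ((d - a) / √2)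
  have h2 := (((Real.hasDerivAt_sigmoid ((d - a) / √2 * x)).comp x h1).const_mul
    (d - a)).const_add a
  convert! h2 using 1
  unfold waveProfile
  ring

theorem contDiff_waveProfile (a d : ℝ) : ContDiff ℝ 2 (waveProfile a d) := by
  unfold waveProfile
  have h : ContDiff ℝ 2 Real.sigmoid := contDiff_sigmoid.of_le le_top
  fun_prop

/-- The explicit travelling wave for a cubic nonlinearity with zeros `a < b < d`. -/
theorem isTravellingWave_waveProfile (hab : a < b) (hbd : b < d)
    (hfac : ∀ u, reaction u + δ = (u - a) * (d - u) * (u - b)) :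
    IsTravellingWave δ (√2 * (b - (a + d) / 2)) (waveProfile a d) where
  contDiff := contDiff_waveProfile a d
  strictMono := by
    have hda : 0 < d - a := by linarith
    intro x y hxy
    have h := Real.sigmoid_strictMono (mul_lt_mul_of_pos_left hxy
      (show 0 < (d - a) / √2 by positivity))
    have := mul_lt_mul_of_pos_left h hda
    unfold waveProfile
    linarith
  ode x := by
    have h1 : deriv (waveProfile a d) =
        fun x => (waveProfile a d x - a) * (d - waveProfile a d x) / √2 :=
      funext fun x => (hasDerivAt_waveProfile a d x).deriv
    have hm := hasDerivAt_waveProfile a d x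
    have h2 := ((hm.sub_const a).mul (hm.const_sub d)).div_const √2
    have h3 := h2.deriv
    simp only [Pi.mul_apply] at h3
    rw [h1, h3, hfac]
    have h4 : √2 * √2 = 2 := Real.mul_self_sqrt (by norm_num)
    have h5 : √2 ≠ 0 := by positivity
    field_simp
    rw [pow_two, h4]
    ring
  tendsto_atTop := by
    have hda : 0 < d - a := by linarith
    rw [mPlus_eq hab hbd hfac]
    have h : Tendsto (fun x : ℝ => (d - a) / √2 * x) atTop atTop :=
      tendsto_id.const_mul_atTop (by positivity)
    have := ((Real.tendsto_sigmoid_atTop.comp h).const_mul (d - a)).const_add a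
    simpa [waveProfile, Function.comp_def] using! this
  tendsto_atBot := by
    have hda : 0 < d - a := by linarith
    rw [mMinus_eq hab hbd hfac]
    have h : Tendsto (fun x : ℝ => (d - a) / √2 * x) atBot atBot :=
      tendsto_id.const_mul_atBot (by positivity)
    have := ((Real.tendsto_sigmoid_atBot.comp h).const_mul (d - a)).const_add a
    simpa [waveProfile, Function.comp_def] using! this

theorem tendsto_atTop_of_deriv_tendsto_pos {G g : ℝ → ℝ} {l : ℝ} (hl : 0 < l)
    (hG : ∀ x, HasDerivAt G (g x) x) (hg : Tendsto g atTop (𝓝 l)) : Tendsto G atTop atTop := by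
  obtain ⟨x₀, hx₀⟩ := eventually_atTop.1 (hg.eventually (lt_mem_nhds (half_lt_self hl)))
  have hmono : MonotoneOn (fun x => G x - l / 2 * x) (Ici x₀) := by
    have hd : ∀ x, HasDerivAt (fun x => G x - l / 2 * x) (g x - l / 2) x := fun x => by
      simpa using! (hG x).sub ((hasDerivAt_id x).const_mul (l / 2))
    refine monotoneOn_of_deriv_nonneg (convex_Ici x₀)
      (fun x _ => (hd x).continuousAt.continuousWithinAt)
      (fun x _ => (hd x).differentiableAt.differentiableWithinAt) fun x hx => ?_
    rw [interior_Ici] at hx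
    rw [(hd x).deriv]
    linarith [hx₀ x hx.le]
  refine tendsto_atTop_mono' atTop (f₁ := fun x => l / 2 * x + (G x₀ - l / 2 * x₀)) ?_ ?_
  · filter_upwards [eventually_ge_atTop x₀] with x hx
    have := hmono self_mem_Ici hx hx
    simp only at this
    linarith
  · exact tendsto_atTop_add_const_right _ _ (tendsto_id.const_mul_atTop (by positivity))

theorem tendsto_atBot_atTop_of_deriv_tendsto_neg {G g : ℝ → ℝ} {l : ℝ} (hl : l < 0)
    (hG : ∀ x, HasDerivAt G (g x) x) (hg : Tendsto g atBot (𝓝 l)) : Tendsto G atBot atTop := by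
  have h := tendsto_atTop_of_deriv_tendsto_pos (G := fun x => G (-x)) (g := fun x => -g (-x))
    (l := -l) (by linarith)
    (fun x => by simpa using! (hG (-x)).scomp x (hasDerivAt_neg x))
    ((hg.comp tendsto_neg_atTop_atBot).neg)
  simpa [Function.comp_def] using h.comp tendsto_neg_atBot_atTop

theorem IsTravellingWave.mem_Icc {c : ℝ} {m : ℝ → ℝ} (h : IsTravellingWave δ c m) (x : ℝ) :
    m x ∈ Icc (mMinus δ) (mPlus δ) :=
  ⟨h.strictMono.monotone.le_of_tendsto h.tendsto_atBot x,
    h.strictMono.monotone.ge_of_tendsto h.tendsto_atTop x⟩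

theorem IsTravellingWave.hasDerivAt {c : ℝ} {m : ℝ → ℝ} (h : IsTravellingWave δ c m) (x : ℝ) :
    HasDerivAt m (deriv m x) x :=
  (h.contDiff.differentiable (by norm_num)).differentiableAt.hasDerivAt

theorem IsTravellingWave.hasDerivAt_deriv {c : ℝ} {m : ℝ → ℝ} (h : IsTravellingWave δ c m)
    (x : ℝ) : HasDerivAt (deriv m) (-(c * deriv m x) - (reaction (m x) + δ)) x := by
  have h1 : ContDiff ℝ 1 (deriv m) := by
    have := h.contDiff
    rw [show (2 : WithTop ℕ∞) = 1 + 1 by norm_num, contDiff_succ_iff_deriv] at this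
    exact this.2.2
  have h2 := (h1.differentiable (by norm_num)).differentiableAt.hasDerivAt (x := x)
  rwa [show deriv (deriv m) x = -(c * deriv m x) - (reaction (m x) + δ) by
    linarith [h.ode x]] at h2

/-- By the equation `m' + c m` is Lipschitz, since `f(m) + δ` is bounded; by the mean value theorem
every `x` has a point within distance 1 where `|m'|` is at most the oscillation of `m`. -/
theorem IsTravellingWave.exists_abs_deriv_le {c : ℝ} {m : ℝ → ℝ} (h : IsTravellingWave δ c m) :
    ∃ M, ∀ x, |deriv m x| ≤ M := by
  set I := Icc (mMinus δ) (mPlus δ)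
  have hcont : ContinuousOn (fun u => reaction u + δ) I := by
    unfold reaction; fun_prop
  obtain ⟨K, hK⟩ := isCompact_Icc.exists_bound_of_continuousOn hcont
  have hbd : ∀ x y, |m x - m y| ≤ mPlus δ - mMinus δ := fun x y => by
    have hx := h.mem_Icc x
    have hy := h.mem_Icc y
    exact abs_sub_le_iff.2 ⟨by linarith [hx.2, hy.1], by linarith [hx.1, hy.2]⟩
  set D := mPlus δ - mMinus δ
  have hφ : ∀ x y, ‖(deriv m y + c * m y) - (deriv m x + c * m x)‖ ≤ K * ‖y - x‖ := fun x y => by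
    refine convex_univ.norm_image_sub_le_of_norm_hasDerivWithin_le
      (f := fun x => deriv m x + c * m x) (f' := fun x => -(reaction (m x) + δ))
      (fun z _ => ?_) (fun z _ => ?_) (mem_univ x) (mem_univ y)
    · refine HasDerivAt.hasDerivWithinAt ?_
      convert! (h.hasDerivAt_deriv z).add ((h.hasDerivAt z).const_mul c) using 1
      ring
    · rw [norm_neg]
      exact hK _ (h.mem_Icc z)
  refine ⟨D + (K + |c| * D), fun x => ?_⟩
  obtain ⟨y, hy, hy'⟩ := exists_deriv_eq_slope m (lt_add_one x)
    h.contDiff.continuous.continuousOn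
    (h.contDiff.differentiable (by norm_num)).differentiableOn
  rw [add_sub_cancel_left, div_one] at hy'
  have hK0 : 0 ≤ K := (norm_nonneg _).trans (hK _ (h.mem_Icc x))
  have h1 := hφ y x
  rw [Real.norm_eq_abs, Real.norm_eq_abs] at h1
  have h2 : |x - y| ≤ 1 := abs_le.2 ⟨by linarith [hy.2], by linarith [hy.1]⟩
  have h3 : |deriv m y| ≤ D := hy' ▸ hbd _ _
  have h4 : |c * (m y - m x)| ≤ |c| * D := by
    rw [abs_mul]; exact mul_le_mul_of_nonneg_left (hbd _ _) (abs_nonneg _)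
  calc |deriv m x|
      = |deriv m y + (((deriv m x + c * m x) - (deriv m y + c * m y)) + c * (m y - m x))| := by
        congr 1; ring
    _ ≤ |deriv m y| + (|(deriv m x + c * m x) - (deriv m y + c * m y)| + |c * (m y - m x)|) :=
        (abs_add_le _ _).trans (add_le_add_right (abs_add_le _ _) _)
    _ ≤ D + (K + |c| * D) := by
        gcongr
        exact h1.trans (mul_le_of_le_one_right hK0 h2)

/-- Measure how far an arbitrary wave is from the logistic equation. With an integrating factor that
decays at both ends, this defect becomes a monotone function vanishing at `±∞`, hence zero, and the
speed error `e` must vanish with it. -/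
theorem IsTravellingWave.speed_eq {c : ℝ} {m : ℝ → ℝ} (h : IsTravellingWave δ c m)
    (hab : a < b) (hbd : b < d)
    (hfac : ∀ u, reaction u + δ = (u - a) * (d - u) * (u - b)) :
    c = √2 * (b - (a + d) / 2) := by
  have hP := mPlus_eq hab hbd hfac
  have hM := mMinus_eq hab hbd hfac
  have hsq : √2 * √2 = 2 := Real.mul_self_sqrt (by norm_num)
  have hs0 : 0 < √2 := by positivity
  set e : ℝ := c - √2 * (b - (a + d) / 2) with he
  have hmc : Continuous m := h.contDiff.continuous
  -- the deviation from the logistic equation solves a linear equation with source `-e m'`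
  set v : ℝ → ℝ := fun x => deriv m x - (m x - a) * (d - m x) / √2 with hv
  have hvd : ∀ x, HasDerivAt v (√2 * (m x - b) * v x - e * deriv m x) x := fun x => by
    convert! (h.hasDerivAt_deriv x).sub
      ((((h.hasDerivAt x).sub_const a).mul ((h.hasDerivAt x).const_sub d)).div_const √2) using 1
    simp only [hv, he, hfac]
    field_simp
    linear_combination
      (2 * (m x - b) * deriv m x + (b * 2 - (a + d)) * deriv m x) * hsq
  -- The integrand tends to a positive limit at `+∞` and a negative one at `-∞`, because `a < b <
  -- d`; so `G → +∞` at both ends and `exp (-G)` kills the bounded `v` there.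
  set G : ℝ → ℝ := fun x => ∫ y in (0 : ℝ)..x, √2 * (m y - b) with hG
  have hGd : ∀ x, HasDerivAt G (√2 * (m x - b)) x := fun x => by
    have hc : Continuous fun y => √2 * (m y - b) := by fun_prop
    exact intervalIntegral.integral_hasDerivAt_right (hc.intervalIntegrable _ _)
      (hc.stronglyMeasurableAtFilter _ _) hc.continuousAt
  have hGt : Tendsto G atTop atTop := by
    refine tendsto_atTop_of_deriv_tendsto_pos (l := √2 * (d - b)) (mul_pos hs0 (by linarith)) hGd ?_
    have := h.tendsto_atTop
    rw [hP] at this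
    exact (this.sub_const b).const_mul _
  have hGb : Tendsto G atBot atTop := by
    refine tendsto_atBot_atTop_of_deriv_tendsto_neg (l := √2 * (a - b))
      (mul_neg_of_pos_of_neg hs0 (by linarith)) hGd ?_
    have := h.tendsto_atBot
    rw [hM] at this
    exact (this.sub_const b).const_mul _
  set E : ℝ → ℝ := fun x => Real.exp (-G x) with hE
  have hEt : Tendsto E atTop (𝓝 0) := Real.tendsto_exp_neg_atTop_nhds_zero.comp hGt
  have hEb : Tendsto E atBot (𝓝 0) := Real.tendsto_exp_neg_atTop_nhds_zero.comp hGb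
  have hvE : ∀ x, HasDerivAt (fun x => v x * E x) (-e * (deriv m x * E x)) x := fun x => by
    convert! (hvd x).mul ((hGd x).neg.exp) using 1
    simp only [hE, Pi.neg_apply]
    ring
  obtain ⟨M, hM'⟩ := h.exists_abs_deriv_le
  have hvb : ∃ N, ∀ x, |v x| ≤ N := by
    refine ⟨M + (d - a) * (d - a) / √2, fun x => ?_⟩
    have hx := h.mem_Icc x
    rw [hP, hM] at hx
    have h1 : |(m x - a) * (d - m x) / √2| ≤ (d - a) * (d - a) / √2 := by
      rw [abs_of_nonneg (div_nonneg (mul_nonneg (by linarith [hx.1]) (by linarith [hx.2])) hs0.le)]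
      gcongr
      · linarith [hx.2]
      · linarith
      · exact hx.2
      · exact hx.1
    exact (abs_sub _ _).trans (add_le_add (hM' x) h1)
  obtain ⟨N, hN⟩ := hvb
  have hlim : ∀ l : Filter ℝ, Tendsto E l (𝓝 0) → Tendsto (fun x => v x * E x) l (𝓝 0) :=
    fun l hl => by
      refine squeeze_zero_norm (a := fun x => N * E x) (fun x => ?_) (by simpa using hl.const_mul N)
      rw [norm_mul, Real.norm_eq_abs, Real.norm_eq_abs, abs_of_pos (Real.exp_pos (-G x))]
      exact mul_le_mul_of_nonneg_right (hN x) (Real.exp_pos _).le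
  have hvEt := hlim _ hEt
  have hvEb := hlim _ hEb
  have hm0 : ∀ x, 0 ≤ deriv m x := fun x => h.strictMono.monotone.deriv_nonneg
  have hdE : ∀ x, 0 ≤ deriv m x * E x := fun x => mul_nonneg (hm0 x) (Real.exp_pos _).le
  -- As `m' ≥ 0`, the derivative `-e m' E` has a constant sign.
  have hzero : ∀ x, v x * E x = 0 := by
    rcases le_total 0 e with h0 | h0
    · have hanti : Antitone fun x => v x * E x :=
        antitone_of_hasDerivAt_nonpos hvE fun x => by
          have := mul_nonneg h0 (hdE x); simp only [Pi.zero_apply]; linarith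
      exact fun x => le_antisymm (hanti.ge_of_tendsto hvEb x) (hanti.le_of_tendsto hvEt x)
    · have hmono : Monotone fun x => v x * E x :=
        monotone_of_hasDerivAt_nonneg hvE fun x => mul_nonneg (by linarith) (hdE x)
      exact fun x => le_antisymm (hmono.ge_of_tendsto hvEt x) (hmono.le_of_tendsto hvEb x)
  have hez : ∀ x, e * deriv m x = 0 := fun x => by
    have h1 := hvE x
    simp only [hzero] at h1
    have h2 := h1.unique (hasDerivAt_const x (0 : ℝ))
    have h3 : E x ≠ 0 := (Real.exp_pos _).ne'
    have h4 : (e * deriv m x) * E x = 0 := by linarith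
    exact (mul_eq_zero.1 h4).resolve_right h3
  by_contra hne
  have hene : e ≠ 0 := fun h0 => hne (by linarith)
  have hm' : ∀ x, deriv m x = 0 := fun x => (mul_eq_zero.1 (hez x)).resolve_left hene
  have := is_const_of_deriv_eq_zero (h.contDiff.differentiable (by norm_num)) hm' 0 1
  exact (h.strictMono zero_lt_one).ne this

end Wave

/-! ### The wave speed for small forcing. -/

/-- For `b` the middle zero of `f + δ`, the unique wave speed is `c₀ b`. -/
theorem existsUnique_speed {δ b : ℝ} (hb : |b| ≤ 1 / 2) (hδ : reaction b + δ = 0) :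
    (∃ m, IsTravellingWave δ (c₀ * b) m) ∧
      ∀ c, (∃ m, IsTravellingWave δ c m) → c = c₀ * b := by
  have hb2 : b ^ 2 ≤ 1 / 4 := by
    have := (sq_le_sq' (abs_le.1 hb).1 (abs_le.1 hb).2)
    linarith
  -- Dividing the cubic by `u - b` leaves `1 - b² - b u - u²`, with zeros `(-b ± s) / 2`; they
  -- enclose `b` exactly when `|3 b| < s`.
  set s := √(4 - 3 * b ^ 2) with hs
  have hss : s * s = 4 - 3 * b ^ 2 := Real.mul_self_sqrt (by linarith)
  have hs0 : 0 ≤ s := Real.sqrt_nonneg _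
  have h3 : |3 * b| < s := abs_lt_of_sq_lt_sq (by nlinarith) hs0
  have hab : (-b - s) / 2 < b := by linarith [(abs_lt.1 h3).1]
  have hbd : b < (-b + s) / 2 := by linarith [(abs_lt.1 h3).2]
  have hfac : ∀ u, reaction u + δ = (u - (-b - s) / 2) * ((-b + s) / 2 - u) * (u - b) := fun u => by
    have : δ = b ^ 3 - b := by unfold reaction at hδ; linarith
    rw [this]
    unfold reaction
    linear_combination (-(u - b) / 4) * hss
  have hc : √2 * (b - ((-b - s) / 2 + (-b + s) / 2) / 2) = c₀ * b := by
    rw [c₀_eq]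
    have h4 : √2 * √2 = 2 := Real.mul_self_sqrt (by norm_num)
    have h5 : √2 ≠ 0 := by positivity
    field_simp
    rw [pow_two, h4]
    ring
  refine ⟨⟨_, hc ▸ isTravellingWave_waveProfile hab hbd hfac⟩, ?_⟩
  rintro c ⟨m, hm⟩
  rw [← hc]
  exact hm.speed_eq hab hbd hfac

/-- Intermediate value theorem on `[-1/2, 1/2]`; the bound is `f(1/2) = 3/8`. -/
theorem exists_middle_zero {δ : ℝ} (hδ : |δ| ≤ 3 / 8) :
    ∃ b, |b| ≤ 1 / 2 ∧ reaction b + δ = 0 := by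
  have hc : ContinuousOn reaction (Icc (-1 / 2) (1 / 2)) := by
    unfold reaction; fun_prop
  have h := intermediate_value_Icc (by norm_num) hc
  have h1 : -δ ∈ Icc (reaction (-1 / 2)) (reaction (1 / 2)) := by
    unfold reaction
    constructor <;> linarith [(abs_le.1 hδ).1, (abs_le.1 hδ).2]
  obtain ⟨b, hb, hb'⟩ := h h1
  exact ⟨b, abs_le.2 ⟨by linarith [hb.1], hb.2⟩, by linarith⟩

theorem hasWaveSpeed_of_abs_le {δ : ℝ} (hδ : |δ| ≤ 3 / 8) : HasWaveSpeed δ := by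
  obtain ⟨b, hb, hb'⟩ := exists_middle_zero hδ
  have h := existsUnique_speed hb hb'
  exact ⟨c₀ * b, h.1, h.2⟩

theorem waveSpeed_eq {δ b : ℝ} (hb : |b| ≤ 1 / 2) (hδ : reaction b + δ = 0) :
    waveSpeed δ = c₀ * b := by
  have h := existsUnique_speed hb hδ
  exact h.2 _ (Classical.epsilon_spec (p := fun c : ℝ => ∃ m, IsTravellingWave δ c m) ⟨_, h.1⟩)

theorem abs_waveSpeed_add_le {δ : ℝ} (hδ : |δ| ≤ 3 / 8) :
    |waveSpeed δ + c₀ * δ| ≤ 3 * c₀ * |δ| ^ 3 := by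
  obtain ⟨b, hb, hb'⟩ := exists_middle_zero hδ
  rw [waveSpeed_eq hb hb']
  have h1 : δ = -(b * (1 - b ^ 2)) := by unfold reaction at hb'; linarith
  have hb2 : b ^ 2 ≤ 1 / 4 := by
    have := (sq_le_sq' (abs_le.1 hb).1 (abs_le.1 hb).2)
    linarith
  have h2 : |b| ≤ 4 / 3 * |δ| := by
    rw [h1, abs_neg, abs_mul, abs_of_nonneg (by linarith : 0 ≤ 1 - b ^ 2)]
    nlinarith [abs_nonneg b]
  have h3 : c₀ * b + c₀ * δ = c₀ * b ^ 3 := by rw [h1]; ring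
  rw [h3, abs_mul, abs_of_pos c₀_pos, abs_pow]
  have h4 : |b| ^ 3 ≤ (4 / 3 * |δ|) ^ 3 := pow_le_pow_left₀ (abs_nonneg _) h2 3
  have h5 : |b| ^ 3 ≤ 3 * |δ| ^ 3 := by
    nlinarith [pow_nonneg (abs_nonneg δ) 3]
  nlinarith [c₀_pos]

/-- On `[-1/2, 1/2]` the difference quotients of `f` are at least `1/4`, so the middle zero is
4-Lipschitz in `δ`. This serves the continuity of the integrand. -/
theorem lipschitzOnWith_waveSpeed :
    LipschitzOnWith (4 * c₀).toNNReal waveSpeed {δ | |δ| ≤ 3 / 8} := by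
  refine LipschitzOnWith.of_dist_le_mul fun x hx y hy => ?_
  obtain ⟨p, hp, hp'⟩ := exists_middle_zero hx
  obtain ⟨q, hq, hq'⟩ := exists_middle_zero hy
  have hc := c₀_pos
  rw [waveSpeed_eq hp hp', waveSpeed_eq hq hq', Real.coe_toNNReal _ (by positivity),
    Real.dist_eq, Real.dist_eq, ← mul_sub, abs_mul, abs_of_pos hc, mul_comm 4 c₀, mul_assoc]
  refine mul_le_mul_of_nonneg_left ?_ hc.le
  have h1 : x - y = -((p - q) * (1 - (p ^ 2 + p * q + q ^ 2))) := by
    unfold reaction at hp' hq'; linarith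
  have h2 : 1 / 4 ≤ 1 - (p ^ 2 + p * q + q ^ 2) := by
    have := (sq_le_sq' (abs_le.1 hp).1 (abs_le.1 hp).2)
    have := (sq_le_sq' (abs_le.1 hq).1 (abs_le.1 hq).2)
    nlinarith [sq_nonneg (p - q)]
  rw [h1, abs_neg, abs_mul, abs_of_nonneg (by linarith : 0 ≤ 1 - (p ^ 2 + p * q + q ^ 2))]
  nlinarith [abs_nonneg (p - q)]

/-! ### Mollified paths: size of the noise and approximation error. -/

section Mollification

variable {ρ : ℝ → ℝ} {γ ε : ℝ} {w : ℝ → ℝ}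

theorem contDiff_scaledKernel (hρ : IsMollifier ρ) (γ ε : ℝ) :
    ContDiff ℝ ((⊤ : ℕ∞) : WithTop ℕ∞) (scaledKernel ρ γ ε) := by
  have := hρ.smooth
  unfold scaledKernel
  fun_prop

theorem scaledKernel_eq_zero (hρ : IsMollifier ρ) (hε : 0 < ε) {x : ℝ}
    (hx : x ∉ Icc (-ε ^ γ) (ε ^ γ)) : scaledKernel ρ γ ε x = 0 := by
  have hη : 0 < ε ^ γ := Real.rpow_pos_of_pos hε γ
  rw [scaledKernel, hρ.eq_zero, mul_zero]
  contrapose! hx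
  rw [mem_Icc, le_div_iff₀ hη, div_le_iff₀ hη] at hx
  constructor <;> linarith [hx.1, hx.2]

theorem scaledKernel_nonneg (hρ : IsMollifier ρ) (hε : 0 < ε) (x : ℝ) :
    0 ≤ scaledKernel ρ γ ε x :=
  mul_nonneg (Real.rpow_nonneg hε.le _) (hρ.nonneg _)

theorem hasCompactSupport_scaledKernel (hρ : IsMollifier ρ) (hε : 0 < ε) :
    HasCompactSupport (scaledKernel ρ γ ε) :=
  HasCompactSupport.intro isCompact_Icc fun _ hx => scaledKernel_eq_zero hρ hε hx

theorem integral_scaledKernel (hρ : IsMollifier ρ) (hε : 0 < ε) :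
    ∫ x, scaledKernel ρ γ ε x = 1 := by
  have hη : 0 < ε ^ γ := Real.rpow_pos_of_pos hε γ
  simp only [scaledKernel]
  rw [integral_const_mul, Measure.integral_comp_div ρ, hρ.integral_eq_one, Real.rpow_neg hε.le,
    abs_of_pos hη, smul_eq_mul, mul_one, inv_mul_cancel₀ hη.ne']

theorem mollified_eq_convolution (ρ : ℝ → ℝ) (γ : ℝ) (w : ℝ → ℝ) (ε : ℝ) :
    mollified ρ γ w ε =
      MeasureTheory.convolution w (scaledKernel ρ γ ε) (ContinuousLinearMap.mul ℝ ℝ) volume := by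
  ext t
  simp only [mollified, convolution, ContinuousLinearMap.mul_apply', mul_comm]

theorem contDiff_mollified (hρ : IsMollifier ρ) (hw : Continuous w) (hε : 0 < ε) :
    ContDiff ℝ ((⊤ : ℕ∞) : WithTop ℕ∞) (mollified ρ γ w ε) := by
  rw [mollified_eq_convolution]
  exact (hasCompactSupport_scaledKernel hρ hε).contDiff_convolution_right _
    hw.locallyIntegrable (contDiff_scaledKernel hρ γ ε)

theorem hasDerivAt_mollified (hρ : IsMollifier ρ) (hw : Continuous w) (hε : 0 < ε) (t : ℝ) :
    HasDerivAt (mollified ρ γ w ε) (noise ρ γ w ε t) t :=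
  ((contDiff_mollified hρ hw hε).differentiable (by simp)).differentiableAt.hasDerivAt

theorem continuous_noise (hρ : IsMollifier ρ) (hw : Continuous w) (hε : 0 < ε) :
    Continuous (noise ρ γ w ε) :=
  (contDiff_mollified hρ hw hε).continuous_deriv (by simp)

theorem noise_eq (hρ : IsMollifier ρ) (hw : Continuous w) (hε : 0 < ε) (t : ℝ) :
    noise ρ γ w ε t = ∫ y, w (t - y) * deriv (scaledKernel ρ γ ε) y := by
  have h := (hasCompactSupport_scaledKernel (γ := γ) hρ hε).hasDerivAt_convolution_right
    (ContinuousLinearMap.mul ℝ ℝ) (hw.locallyIntegrable (μ := volume))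
    ((contDiff_scaledKernel hρ γ ε).of_le (by simp)) t
  rw [noise, mollified_eq_convolution, h.deriv, convolution]
  simp only [ContinuousLinearMap.mul_apply']
  rw [← integral_sub_left_eq_self _ volume t]
  simp

/-- The derivative falls on the kernel and costs `K ε^(-2γ)`, over a support of length `2 ε^γ`. -/
theorem abs_noise_le (hρ : IsMollifier ρ) (hw : Continuous w) (hε : 0 < ε) {K M t : ℝ}
    (hK : ∀ x, |deriv ρ x| ≤ K)
    (hM : ∀ y ∈ Icc (-ε ^ γ) (ε ^ γ), |w (t - y)| ≤ M) :
    |noise ρ γ w ε t| ≤ 2 * M * K * ε ^ (-γ) := by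
  have hη : 0 < ε ^ γ := Real.rpow_pos_of_pos hε γ
  have hk : ∀ x, deriv (scaledKernel ρ γ ε) x = ε ^ (-γ) * (deriv ρ (x / ε ^ γ) / ε ^ γ) := by
    intro x
    have h1 : HasDerivAt (fun x : ℝ => x / ε ^ γ) (1 / ε ^ γ) x := (hasDerivAt_id x).div_const _
    have h2 : HasDerivAt ρ (deriv ρ (x / ε ^ γ)) (x / ε ^ γ) :=
      (hρ.smooth.differentiable (by simp)).differentiableAt.hasDerivAt
    have h3 := (h2.comp x h1).const_mul (ε ^ (-γ))
    have h4 := h3.deriv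
    rw [mul_one_div] at h4
    exact h4
  have hk0 : ∀ y ∉ Icc (-ε ^ γ) (ε ^ γ), w (t - y) * deriv (scaledKernel ρ γ ε) y = 0 := by
    intro y hy
    have : deriv (scaledKernel ρ γ ε) y = 0 := by
      have h0 : scaledKernel ρ γ ε =ᶠ[𝓝 y] fun _ => 0 := by
        filter_upwards [isClosed_Icc.isOpen_compl.mem_nhds hy] with z hz
        exact scaledKernel_eq_zero hρ hε hz
      rw [h0.deriv_eq]
      simp
    rw [this, mul_zero]
  rw [noise_eq hρ hw hε, ← setIntegral_eq_integral_of_forall_compl_eq_zero hk0, ← Real.norm_eq_abs]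
  refine (norm_setIntegral_le_of_norm_le_const (C := M * (ε ^ (-γ) * (K / ε ^ γ)))
    (by simp) fun y hy => ?_).trans_eq ?_
  · have hM0 := (abs_nonneg _).trans (hM y hy)
    rw [norm_mul, Real.norm_eq_abs, Real.norm_eq_abs, hk, abs_mul, abs_div, abs_of_pos hη,
      abs_of_pos (Real.rpow_pos_of_pos hε _)]
    gcongr
    · exact hM y hy
    · exact hK _
  · rw [Measure.real, Real.volume_Icc, ENNReal.toReal_ofReal (by linarith)]
    field_simp
    ring

theorem integrable_scaledKernel_mul (hρ : IsMollifier ρ) (hε : 0 < ε) {g : ℝ → ℝ}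
    (hg : Continuous g) : Integrable fun y => scaledKernel ρ γ ε y * g y := by
  have hc : Continuous (scaledKernel ρ γ ε) := (contDiff_scaledKernel hρ γ ε).continuous
  exact (hc.mul hg).integrable_of_hasCompactSupport
    (hasCompactSupport_scaledKernel hρ hε).mul_right

theorem mollified_sub_eq (hρ : IsMollifier ρ) (hw : Continuous w) (hε : 0 < ε) (t : ℝ) :
    mollified ρ γ w ε t - w t = ∫ y, scaledKernel ρ γ ε y * (w (t - y) - w t) := by
  have h1 : mollified ρ γ w ε t = ∫ y, scaledKernel ρ γ ε y * w (t - y) := by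
    rw [mollified, ← integral_sub_left_eq_self _ volume t]
    simp
  simp only [mul_sub]
  rw [integral_sub (integrable_scaledKernel_mul hρ hε (by fun_prop))
    (integrable_scaledKernel_mul hρ hε continuous_const), integral_mul_const,
    integral_scaledKernel hρ hε, one_mul, h1]

/-- Interpolation: part of the exponent `α'` is traded for a power of the scale `η`, using `l`
itself when `l ≤ η` and `h ≤ η` otherwise. -/
theorem rpow_min_le {h l η α α' : ℝ} (hh : 0 ≤ h) (hhη : h ≤ η) (hl : 0 ≤ l) (hα : 0 ≤ α)
    (hαα' : α < α') : h ^ α' ≤ η ^ (α' - α) * l ^ α ∨ l ^ α' ≤ η ^ (α' - α) * l ^ α := by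
  have hη : 0 ≤ η := hh.trans hhη
  have hsplit : ∀ x : ℝ, 0 ≤ x → x ^ α' = x ^ (α' - α) * x ^ α := fun x hx => by
    rw [← Real.rpow_add_of_nonneg hx (by linarith) hα]
    congr 1
    ring
  rcases le_total l η with h1 | h1
  · right
    rw [hsplit l hl]
    exact mul_le_mul_of_nonneg_right (Real.rpow_le_rpow hl h1 (by linarith))
      (Real.rpow_nonneg hl _)
  · left
    calc h ^ α' ≤ η ^ α' := Real.rpow_le_rpow hh hhη (by linarith)
      _ = η ^ (α' - α) * η ^ α := hsplit η hη
      _ ≤ η ^ (α' - α) * l ^ α :=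
        mul_le_mul_of_nonneg_left (Real.rpow_le_rpow hη h1 hα) (Real.rpow_nonneg hη _)

/-- The error of the mollification is small in a Hölder norm of lower order. -/
theorem abs_mollified_sub_sub_le (hρ : IsMollifier ρ) (hw : Continuous w) (hε : 0 < ε)
    (hε1 : ε ^ γ ≤ 1) {T C α α' : ℝ} (hα : 0 ≤ α) (hαα' : α < α')
    (hC : ∀ x ∈ Icc (-1) (T + 1), ∀ y ∈ Icc (-1) (T + 1), |w x - w y| ≤ C * |x - y| ^ α')
    {s t : ℝ} (hs : s ∈ Icc 0 T) (ht : t ∈ Icc 0 T) :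
    |(mollified ρ γ w ε t - w t) - (mollified ρ γ w ε s - w s)| ≤
      2 * C * (ε ^ γ) ^ (α' - α) * |t - s| ^ α := by
  have hη : 0 < ε ^ γ := Real.rpow_pos_of_pos hε γ
  have hC0 : 0 ≤ C := by
    have h := hC 0 ⟨by norm_num, by linarith [hs.1, hs.2]⟩ (-1)
      ⟨le_rfl, by linarith [hs.1, hs.2]⟩
    norm_num at h
    exact (abs_nonneg _).trans h
  rw [mollified_sub_eq hρ hw hε, mollified_sub_eq hρ hw hε,
    ← integral_sub (integrable_scaledKernel_mul hρ hε (by fun_prop))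
    (integrable_scaledKernel_mul hρ hε (by fun_prop)), ← Real.norm_eq_abs]
  set A := 2 * C * (ε ^ γ) ^ (α' - α) * |t - s| ^ α
  have hA : ∫ y, scaledKernel ρ γ ε y * A = A := by
    rw [integral_mul_const, integral_scaledKernel hρ hε, one_mul]
  rw [← hA]
  refine norm_integral_le_of_norm_le (integrable_scaledKernel_mul hρ hε continuous_const)
    (Eventually.of_forall fun y => ?_)
  rw [← mul_sub, norm_mul, Real.norm_of_nonneg (scaledKernel_nonneg hρ hε y), Real.norm_eq_abs]
  by_cases hy : y ∈ Icc (-ε ^ γ) (ε ^ γ)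
  swap
  · simp [scaledKernel_eq_zero hρ hε hy]
  refine mul_le_mul_of_nonneg_left ?_ (scaledKernel_nonneg hρ hε y)
  have m1 : ∀ r ∈ Icc 0 T, r ∈ Icc (-1) (T + 1) := fun r hr =>
    ⟨by linarith [hr.1], by linarith [hr.2]⟩
  have m2 : ∀ r ∈ Icc 0 T, r - y ∈ Icc (-1) (T + 1) := fun r hr =>
    ⟨by linarith [hr.1, hy.2], by linarith [hr.2, hy.1]⟩
  -- The double increment of `w` can be grouped into two increments of length `|y|` or two of length
  -- `|t - s|`; whichever satisfies the interpolation bound is used.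
  rcases rpow_min_le (abs_nonneg y) (abs_le.2 hy) (abs_nonneg (t - s)) hα hαα' with h | h
  · have h1 := hC _ (m2 t ht) _ (m1 t ht)
    have h2 := hC _ (m2 s hs) _ (m1 s hs)
    rw [show t - y - t = -y by ring, abs_neg] at h1
    rw [show s - y - s = -y by ring, abs_neg] at h2
    have h3 := mul_le_mul_of_nonneg_left h hC0
    refine (abs_sub _ _).trans ?_
    simp only [A]
    linarith
  · have h1 := hC _ (m2 t ht) _ (m2 s hs)
    have h2 := hC _ (m1 t ht) _ (m1 s hs)
    rw [show t - y - (s - y) = t - s by ring] at h1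
    have h3 := mul_le_mul_of_nonneg_left h hC0
    rw [show w (t - y) - w t - (w (s - y) - w s) = (w (t - y) - w (s - y)) - (w t - w s) by ring]
    refine (abs_sub _ _).trans ?_
    simp only [A]
    linarith

end Mollification

/-! ### Hölder norms of functions vanishing at the origin. -/

section Holder

variable {T : ℝ}

theorem holderENorm_le {α : ℝ≥0} {g : ℝ → ℝ} {κ : ℝ} (hT : 0 ≤ T) (hκ : 0 ≤ κ) (h0 : g 0 = 0)
    (hg : ∀ s ∈ Icc 0 T, ∀ t ∈ Icc 0 T, |g t - g s| ≤ κ * |t - s| ^ (α : ℝ)) :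
    holderENorm T α g ≤ ENNReal.ofReal (κ * T ^ (α : ℝ) + κ) := by
  rw [holderENorm, ENNReal.ofReal_add (by positivity) hκ]
  refine add_le_add (iSup_le fun t => ?_) ?_
  · rw [← ofReal_norm]
    refine ENNReal.ofReal_le_ofReal ?_
    have h := hg 0 ⟨le_rfl, hT⟩ t t.2
    rw [h0, sub_zero, sub_zero, abs_of_nonneg t.2.1] at h
    exact h.trans (mul_le_mul_of_nonneg_left (Real.rpow_le_rpow t.2.1 t.2.2 α.2) hκ)
  · refine HolderWith.eHolderNorm_le (C := κ.toNNReal) fun s t => ?_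
    rw [edist_dist, edist_dist, ENNReal.ofReal_rpow_of_nonneg dist_nonneg α.coe_nonneg,
      ENNReal.ofNNReal_toNNReal, ← ENNReal.ofReal_mul hκ]
    exact ENNReal.ofReal_le_ofReal (hg t t.2 s s.2)

/-- Functions vanishing at `0` converge in `C^{0,α}` if the difference has a small Hölder
constant. -/
theorem tendstoHolder_of_holder_bound {α : ℝ≥0} {u : ℝ → ℝ → ℝ} {v : ℝ → ℝ} {C : ℝ} {κ : ℝ → ℝ}
    (hT : 0 ≤ T) (hC : 0 ≤ C) (hu0 : ∀ ε, u ε 0 = 0) (hv0 : v 0 = 0)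
    (hv : ∀ s ∈ Icc 0 T, ∀ t ∈ Icc 0 T, |v t - v s| ≤ C * |t - s| ^ (α : ℝ))
    (hκ : Tendsto κ (𝓝[>] 0) (𝓝 0))
    (hu : ∀ᶠ ε in 𝓝[>] (0 : ℝ), 0 ≤ κ ε ∧ ∀ s ∈ Icc 0 T, ∀ t ∈ Icc 0 T,
      |(u ε t - v t) - (u ε s - v s)| ≤ κ ε * |t - s| ^ (α : ℝ)) :
    TendstoHolder T α u v := by
  refine ⟨(holderENorm_le hT hC hv0 hv).trans_lt ENNReal.ofReal_lt_top, ?_, ?_⟩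
  · filter_upwards [hu] with ε hε
    refine (holderENorm_le hT (add_nonneg hε.1 hC) (hu0 ε) fun s hs t ht => ?_).trans_lt
      ENNReal.ofReal_lt_top
    rw [show u ε t - u ε s = ((u ε t - v t) - (u ε s - v s)) + (v t - v s) by ring, add_mul]
    exact (abs_add_le _ _).trans (add_le_add (hε.2 s hs t ht) (hv s hs t ht))
  · have hlim : Tendsto (fun ε => ENNReal.ofReal (κ ε * T ^ (α : ℝ) + κ ε)) (𝓝[>] 0) (𝓝 0) := by
      have := ENNReal.tendsto_ofReal ((hκ.mul_const (T ^ (α : ℝ))).add hκ)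
      simpa using this
    refine tendsto_of_tendsto_of_tendsto_of_le_of_le' tendsto_const_nhds hlim
      (Eventually.of_forall fun _ => zero_le) ?_
    filter_upwards [hu] with ε hε
    exact holderENorm_le hT hε.1 (by simp [hu0, hv0]) hε.2

end Holder

/-! ### Pathwise convergence for a Hölder path. -/

section Convergence

variable {ρ : ℝ → ℝ} {γ β σ T : ℝ} {w : ℝ → ℝ}

theorem tendsto_rpow_nhdsGT_zero {p : ℝ} (hp : 0 < p) :
    Tendsto (fun ε : ℝ => ε ^ p) (𝓝[>] 0) (𝓝 0) := by
  have h := (Real.continuousAt_rpow_const 0 p (Or.inr hp.le)).tendsto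
  rw [Real.zero_rpow hp.ne'] at h
  exact h.mono_left nhdsWithin_le_nhds

theorem exists_abs_forcing_le (hρ : IsMollifier ρ) (hw : Continuous w) (hγ₀ : 0 < γ)
    (hβ : 1 < β) (hσ : |σ| ≤ 1) :
    ∃ A, 0 ≤ A ∧ ∀ ε, 0 < ε → ε ≤ 1 → ∀ s ∈ Icc 0 T,
      |forcing ρ γ β σ w ε s| ≤ A * ε ^ (1 - γ) := by
  have hρc : HasCompactSupport ρ := HasCompactSupport.intro isCompact_Icc hρ.eq_zero
  obtain ⟨K, hK⟩ := hρc.deriv.exists_bound_of_continuous (hρ.smooth.continuous_deriv (by simp))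
  obtain ⟨M, hM⟩ := (isCompact_Icc (a := (-1 : ℝ)) (b := T + 1)).exists_bound_of_continuousOn
    hw.continuousOn
  refine ⟨2 * |M| * |K| + 1, by positivity, fun ε hε hε1 s hs => ?_⟩
  have hη1 : ε ^ γ ≤ 1 := Real.rpow_le_one hε.le hε1 hγ₀.le
  have h1 := abs_noise_le (γ := γ) (t := s) hρ hw hε (K := |K|) (M := |M|)
    (fun x => (hK x).trans (le_abs_self _))
    fun y hy => (hM (s - y) ⟨by linarith [hs.1, hy.2], by linarith [hs.2, hy.1]⟩).trans
      (le_abs_self _)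
  have h2 : |ε * noise ρ γ w ε s| ≤ 2 * |M| * |K| * ε ^ (1 - γ) := by
    rw [abs_mul, abs_of_pos hε, sub_eq_add_neg, Real.rpow_add hε, Real.rpow_one]
    nlinarith
  have h3 : |σ * ε ^ β| ≤ ε ^ (1 - γ) := by
    rw [abs_mul, abs_of_pos (Real.rpow_pos_of_pos hε β)]
    exact (mul_le_of_le_one_left (Real.rpow_nonneg hε.le _) hσ).trans
      (Real.rpow_le_rpow_of_exponent_ge hε hε1 (by linarith))
  rw [forcing]
  calc _ ≤ |ε * noise ρ γ w ε s| + |σ * ε ^ β| := abs_add_le _ _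
    _ ≤ _ := by linarith

theorem eventually_abs_forcing_le (hρ : IsMollifier ρ) (hw : Continuous w) (hγ₀ : 0 < γ)
    (hγ : γ < 2 / 3) (hβ : 1 < β) (hσ : |σ| ≤ 1) :
    ∀ᶠ ε in 𝓝[>] (0 : ℝ), ∀ s ∈ Icc 0 T, |forcing ρ γ β σ w ε s| ≤ 3 / 8 := by
  obtain ⟨A, -, hA⟩ := exists_abs_forcing_le (T := T) hρ hw hγ₀ hβ hσ
  have h := (tendsto_rpow_nhdsGT_zero (show 0 < 1 - γ by linarith)).const_mul A
  rw [mul_zero] at h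
  filter_upwards [h.eventually_le_const (show (0 : ℝ) < 3 / 8 by norm_num),
    Ioc_mem_nhdsGT zero_lt_one] with ε h1 h2 s hs
  exact (hA ε h2.1 h2.2 s hs).trans h1

theorem continuousOn_waveSpeed_forcing (hρ : IsMollifier ρ) (hw : Continuous w) {ε : ℝ}
    (hε : 0 < ε) (h : ∀ s ∈ Icc 0 T, |forcing ρ γ β σ w ε s| ≤ 3 / 8) :
    ContinuousOn (fun s => ε⁻¹ * waveSpeed (forcing ρ γ β σ w ε s)) (Icc 0 T) := by
  have hc : Continuous (forcing ρ γ β σ w ε) := by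
    have := continuous_noise (γ := γ) hρ hw hε
    unfold forcing
    fun_prop
  exact continuousOn_const.mul
    (lipschitzOnWith_waveSpeed.continuousOn.comp hc.continuousOn fun s hs => h s hs)

/-- The mollified and perturbed wave speeds integrate to `-c₀ w` in the limit. -/
theorem tendstoHolder_Wpm (hρ : IsMollifier ρ) (hw : Continuous w) (hw0 : w 0 = 0)
    (hγ₀ : 0 < γ) (hγ : γ < 2 / 3) (hβ : 1 < β) (hσ : |σ| ≤ 1) (hT : 0 < T)
    {α : ℝ≥0} {C α' : ℝ} (hαα' : α < α') (hα'1 : α' ≤ 1)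
    (hC : ∀ x ∈ Icc (-1) (T + 1), ∀ y ∈ Icc (-1) (T + 1), |w x - w y| ≤ C * |x - y| ^ α') :
    TendstoHolder T α (fun ε t => c₀ * Wpm ρ γ β σ w ε t) (fun t => -(c₀ * w t)) := by
  have hα0 : 0 ≤ (α : ℝ) := α.coe_nonneg
  have hc := c₀_pos
  have hC0 : 0 ≤ C := by
    have h := hC 0 ⟨by norm_num, by linarith⟩ (-1) ⟨le_rfl, by linarith⟩
    norm_num at h
    exact (abs_nonneg _).trans h
  have hpow : ∀ s ∈ Icc 0 T, ∀ t ∈ Icc 0 T, ∀ p : ℝ, α ≤ p →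
      |t - s| ^ p ≤ T ^ (p - α) * |t - s| ^ (α : ℝ) := fun s hs t ht p hp => by
    have h1 : |t - s| ≤ T := abs_sub_le_iff.2 ⟨by linarith [ht.2, hs.1], by linarith [ht.1, hs.2]⟩
    calc |t - s| ^ p = |t - s| ^ (p - α) * |t - s| ^ (α : ℝ) := by
          rw [← Real.rpow_add_of_nonneg (abs_nonneg _) (by linarith) hα0]
          congr 1
          ring
      _ ≤ _ := by
          gcongr
  obtain ⟨A, hA0, hA⟩ := exists_abs_forcing_le (T := T) hρ hw hγ₀ hβ hσ
  -- Lipschitz constant of the nonlinear error: the cubic remainder, with exponent `3 (1 - γ) - 1`,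
  -- plus the shift `±ε^β` divided by `ε`.
  set L : ℝ → ℝ := fun ε => 3 * c₀ * A ^ 3 * ε ^ (2 - 3 * γ) + c₀ * ε ^ (β - 1) with hL
  refine tendstoHolder_of_holder_bound (C := c₀ * (C * T ^ (α' - α)))
    (κ := fun ε => L ε * T ^ (1 - (α : ℝ)) + c₀ * (2 * C * (ε ^ γ) ^ (α' - α)))
    hT.le (by positivity) (fun ε => by simp [Wpm]) (by simp [hw0]) (fun s hs t ht => ?_) ?_ ?_
  · rw [show -(c₀ * w t) - -(c₀ * w s) = -(c₀ * (w t - w s)) by ring, abs_neg, abs_mul,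
      abs_of_pos hc, mul_assoc, mul_assoc]
    gcongr
    exact (hC t ⟨by linarith [ht.1], by linarith [ht.2]⟩ s
      ⟨by linarith [hs.1], by linarith [hs.2]⟩).trans
      (mul_le_mul_of_nonneg_left (hpow s hs t ht α' hαα'.le) hC0)
  · have h1 := tendsto_rpow_nhdsGT_zero (show 0 < 2 - 3 * γ by linarith)
    have h2 := tendsto_rpow_nhdsGT_zero (show 0 < β - 1 by linarith)
    have h3 : Tendsto (fun ε : ℝ => (ε ^ γ) ^ (α' - α)) (𝓝[>] 0) (𝓝 0) := by
      refine (tendsto_rpow_nhdsGT_zero (mul_pos hγ₀ (sub_pos.2 hαα'))).congr' ?_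
      filter_upwards [self_mem_nhdsWithin] with ε hε
      exact Real.rpow_mul (le_of_lt hε) _ _
    have := (((h1.const_mul (3 * c₀ * A ^ 3)).add (h2.const_mul c₀)).mul_const
      (T ^ (1 - (α : ℝ)))).add ((h3.const_mul (2 * C)).const_mul c₀)
    simpa using this
  · filter_upwards [eventually_abs_forcing_le (T := T) hρ hw hγ₀ hγ hβ hσ,
      Ioc_mem_nhdsGT zero_lt_one] with ε hF hε
    obtain ⟨hε0, hε1⟩ := hε
    refine ⟨by positivity, fun s hs t ht => ?_⟩
    have hcont := continuousOn_waveSpeed_forcing hρ hw hε0 hF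
    have hint : ∀ x ∈ Icc 0 T, ∀ y ∈ Icc 0 T, IntervalIntegrable
        (fun s => ε⁻¹ * waveSpeed (forcing ρ γ β σ w ε s)) volume x y := fun x hx y hy =>
      (hcont.mono (ordConnected_Icc.uIcc_subset hx hy)).intervalIntegrable
    have hnoise : Continuous (noise ρ γ w ε) := continuous_noise hρ hw hε0
    have h00 : (0 : ℝ) ∈ Icc 0 T := ⟨le_rfl, hT.le⟩
    have hW : c₀ * Wpm ρ γ β σ w ε t - c₀ * Wpm ρ γ β σ w ε s =
        ∫ r in s..t, ε⁻¹ * waveSpeed (forcing ρ γ β σ w ε r) := by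
      rw [← intervalIntegral.integral_interval_sub_left (hint 0 h00 t ht) (hint 0 h00 s hs), Wpm,
        Wpm, ← mul_assoc, ← mul_assoc, mul_one_div_cancel hc.ne', one_mul, one_mul]
    have hN : ∫ r in s..t, c₀ * noise ρ γ w ε r =
        c₀ * (mollified ρ γ w ε t - mollified ρ γ w ε s) := by
      rw [intervalIntegral.integral_const_mul, intervalIntegral.integral_eq_sub_of_hasDerivAt
        (fun r _ => hasDerivAt_mollified hρ hw hε0 r) (hnoise.intervalIntegrable _ _)]
    have hsum := intervalIntegral.integral_add (hint s hs t ht)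
      ((continuous_const.mul hnoise).intervalIntegrable (μ := volume) s t) (g := fun r =>
        c₀ * noise ρ γ w ε r)
    rw [← hW, hN] at hsum
    have hrem : ‖∫ r in s..t, (ε⁻¹ * waveSpeed (forcing ρ γ β σ w ε r) + c₀ * noise ρ γ w ε r)‖ ≤
        L ε * |t - s| := by
      refine intervalIntegral.norm_integral_le_of_norm_le_const fun r hr => ?_
      have hr' : r ∈ Icc 0 T := ordConnected_Icc.uIcc_subset hs ht (uIoc_subset_uIcc hr)
      have h1 := abs_waveSpeed_add_le (hF r hr')
      have h2 := hA ε hε0 hε1 r hr'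
      have h3 : ε⁻¹ * waveSpeed (forcing ρ γ β σ w ε r) + c₀ * noise ρ γ w ε r =
          ε⁻¹ * (waveSpeed (forcing ρ γ β σ w ε r) + c₀ * forcing ρ γ β σ w ε r) -
            c₀ * (σ * ε ^ (β - 1)) := by
        rw [Real.rpow_sub hε0, Real.rpow_one]
        conv_rhs => rw [mul_add, forcing]
        rw [forcing]
        field_simp
        ring
      have h4 : |forcing ρ γ β σ w ε r| ^ 3 ≤ A ^ 3 * ε ^ (3 - 3 * γ) := by
        refine (pow_le_pow_left₀ (abs_nonneg _) h2 3).trans_eq ?_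
        rw [mul_pow, ← Real.rpow_natCast (ε ^ (1 - γ)), ← Real.rpow_mul hε0.le]
        norm_num
        left
        congr 1
        ring
      have h5 : |ε⁻¹ * (waveSpeed (forcing ρ γ β σ w ε r) + c₀ * forcing ρ γ β σ w ε r)| ≤
          3 * c₀ * A ^ 3 * ε ^ (2 - 3 * γ) := by
        rw [abs_mul, abs_of_pos (inv_pos.2 hε0)]
        calc _ ≤ ε⁻¹ * (3 * c₀ * (A ^ 3 * ε ^ (3 - 3 * γ))) := by
              gcongr
              exact h1.trans (by gcongr)
          _ = _ := by
              rw [show 3 - 3 * γ = 1 + (2 - 3 * γ) by ring, Real.rpow_add hε0, Real.rpow_one]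
              field_simp
      have h6 : |c₀ * (σ * ε ^ (β - 1))| ≤ c₀ * ε ^ (β - 1) := by
        rw [abs_mul, abs_mul, abs_of_pos hc, abs_of_pos (Real.rpow_pos_of_pos hε0 _)]
        gcongr
        exact mul_le_of_le_one_left (Real.rpow_nonneg hε0.le _) hσ
      rw [h3, Real.norm_eq_abs]
      exact (abs_sub _ _).trans (add_le_add h5 h6)
    rw [hsum, Real.norm_eq_abs] at hrem
    have hmol := abs_mollified_sub_sub_le hρ hw hε0 (Real.rpow_le_one hε0.le hε1 hγ₀.le) hα0 hαα'
      hC hs ht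
    have hlin := hpow s hs t ht 1 (by linarith)
    rw [Real.rpow_one] at hlin
    have hL0 : 0 ≤ L ε := by positivity
    calc _ = |(c₀ * Wpm ρ γ β σ w ε t - c₀ * Wpm ρ γ β σ w ε s +
              c₀ * (mollified ρ γ w ε t - mollified ρ γ w ε s)) -
            c₀ * ((mollified ρ γ w ε t - w t) - (mollified ρ γ w ε s - w s))| := by
          congr 1; ring
      _ ≤ L ε * |t - s| + c₀ * (2 * C * (ε ^ γ) ^ (α' - α) * |t - s| ^ (α : ℝ)) := by
          refine (abs_sub _ _).trans (add_le_add hrem ?_)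
          rw [abs_mul, abs_of_pos hc]
          gcongr
      _ ≤ _ := by
          have := mul_le_mul_of_nonneg_left hlin hL0
          linarith

end Convergence

/-! ### Hölder continuity from dyadic increments. -/

section Chaining

/-- Consecutive dyadic floors of `t` coincide or are neighbours at the finer level, so the error is
the geometric tail from level `n + 1` on. -/
theorem abs_sub_floor_le {g : ℝ → ℝ} {q C : ℝ} (hg : Continuous g) (hq0 : 0 < q) (hq1 : q < 1)
    (hC0 : 0 ≤ C)
    (hC : ∀ n k : ℕ, k < 2 ^ n → |g ((k + 1 : ℕ) / 2 ^ n) - g (k / 2 ^ n)| ≤ C * q ^ n)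
    {t : ℝ} (ht : t ∈ Icc 0 1) (n : ℕ) :
    |g (⌊t * 2 ^ n⌋₊ / 2 ^ n) - g t| ≤ C * q * q ^ n / (1 - q) := by
  have hlim : Tendsto (fun n : ℕ => g (⌊t * 2 ^ n⌋₊ / 2 ^ n)) atTop (𝓝 (g t)) :=
    (hg.tendsto t).comp ((tendsto_nat_floor_mul_div_atTop ht.1).comp
      (tendsto_pow_atTop_atTop_of_one_lt (one_lt_two (α := ℝ))))
  refine dist_le_of_le_geometric_of_tendsto q (C * q) hq1 (fun n => ?_) hlim n
  rw [dist_comm, Real.dist_eq]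
  set k := ⌊t * 2 ^ n⌋₊ with hk
  set k' := ⌊t * 2 ^ (n + 1)⌋₊ with hk'
  have ht0 : 0 ≤ t * 2 ^ n := mul_nonneg ht.1 (by positivity)
  have ht0' : 0 ≤ t * 2 ^ (n + 1) := mul_nonneg ht.1 (by positivity)
  have h1 : 2 * k ≤ k' := by
    refine Nat.le_floor ?_
    have := Nat.floor_le ht0
    rw [← hk] at this
    push_cast
    rw [pow_succ]
    linarith
  have h2 : k' < 2 * k + 2 := by
    rw [hk', Nat.floor_lt ht0']
    have := Nat.lt_floor_add_one (t * 2 ^ n)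
    rw [← hk] at this
    push_cast
    rw [pow_succ]
    linarith
  have h3 : k' ≤ 2 ^ (n + 1) := by
    have : ((k' : ℕ) : ℝ) ≤ ((2 ^ (n + 1) : ℕ) : ℝ) := by
      push_cast
      exact (Nat.floor_le ht0').trans (mul_le_of_le_one_left (by positivity) ht.2)
    exact_mod_cast this
  have h4 : (k : ℝ) / 2 ^ n = ((2 * k : ℕ) : ℝ) / 2 ^ (n + 1) := by
    push_cast
    rw [pow_succ]
    field_simp
  rw [h4, mul_assoc, ← pow_succ']
  obtain h5 | h5 : k' = 2 * k ∨ k' = 2 * k + 1 := by omega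
  · rw [h5, sub_self, abs_zero]
    positivity
  · rw [h5]
    exact hC (n + 1) (2 * k) (by omega)

/-- Control of the increments over neighbouring dyadic points gives Hölder continuity. -/
theorem exists_holder_of_dyadic {g : ℝ → ℝ} {α C : ℝ} (hg : Continuous g) (hα : 0 < α)
    (hC0 : 0 ≤ C)
    (hC : ∀ n k : ℕ, k < 2 ^ n →
      |g ((k + 1 : ℕ) / 2 ^ n) - g (k / 2 ^ n)| ≤ C * ((1 / 2 : ℝ) ^ α) ^ n) :
    ∃ C', ∀ s ∈ Icc (0 : ℝ) 1, ∀ t ∈ Icc (0 : ℝ) 1, |g t - g s| ≤ C' * |t - s| ^ α := by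
  set q : ℝ := (1 / 2 : ℝ) ^ α with hq
  have hq0 : 0 < q := by positivity
  have hq1 : q < 1 := Real.rpow_lt_one (by norm_num) (by norm_num) hα
  set D := C + 2 * (C * q / (1 - q)) with hD
  have hD0 : 0 ≤ D := by
    have : 0 < 1 - q := by linarith
    positivity
  have key : ∀ s ∈ Icc (0 : ℝ) 1, ∀ t ∈ Icc (0 : ℝ) 1, s < t →
      |g t - g s| ≤ D * 2 ^ α * |t - s| ^ α := by
    intro s hs t ht hst
    rw [abs_of_pos (sub_pos.2 hst)]
    -- At the level with `2^(-n-1) < t - s ≤ 2^(-n)` the two floors differ by at most one: one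
    -- dyadic step and two tails, whence `D`.
    obtain ⟨n, hn1, hn2⟩ := exists_nat_pow_near_of_lt_one (sub_pos.2 hst)
      (by linarith [hs.1, ht.2] : t - s ≤ 1) (show (0 : ℝ) < 1 / 2 by norm_num) (by norm_num)
    have h2n : (0 : ℝ) < 2 ^ n := by positivity
    have hle : t * 2 ^ n ≤ s * 2 ^ n + 1 := by
      rw [one_div_pow, le_div_iff₀ h2n] at hn2
      linarith
    have hs0 : 0 ≤ s * 2 ^ n := mul_nonneg hs.1 h2n.le
    have ht0 : 0 ≤ t * 2 ^ n := mul_nonneg ht.1 h2n.le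
    have h1 : ⌊s * 2 ^ n⌋₊ ≤ ⌊t * 2 ^ n⌋₊ := Nat.floor_mono (by gcongr)
    have h2 : ⌊t * 2 ^ n⌋₊ ≤ ⌊s * 2 ^ n⌋₊ + 1 := by
      rw [← Nat.floor_add_one hs0]
      exact Nat.floor_mono hle
    have h3 : ⌊t * 2 ^ n⌋₊ ≤ 2 ^ n := by
      have : (⌊t * 2 ^ n⌋₊ : ℝ) ≤ ((2 ^ n : ℕ) : ℝ) := by
        push_cast
        exact (Nat.floor_le ht0).trans (mul_le_of_le_one_left (by positivity) ht.2)
      exact_mod_cast this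
    have h4 : |g (⌊t * 2 ^ n⌋₊ / 2 ^ n) - g (⌊s * 2 ^ n⌋₊ / 2 ^ n)| ≤ C * q ^ n := by
      obtain h5 | h5 : ⌊t * 2 ^ n⌋₊ = ⌊s * 2 ^ n⌋₊ ∨ ⌊t * 2 ^ n⌋₊ = ⌊s * 2 ^ n⌋₊ + 1 := by omega
      · rw [h5, sub_self, abs_zero]
        positivity
      · rw [h5]
        exact hC n _ (by omega)
    have h5 := abs_sub_floor_le hg hq0 hq1 hC0 hC hs n
    have h6 := abs_sub_floor_le hg hq0 hq1 hC0 hC ht n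
    have h7 : |g t - g s| ≤ D * q ^ n := by
      have e : g t - g s = (g (⌊t * 2 ^ n⌋₊ / 2 ^ n) - g (⌊s * 2 ^ n⌋₊ / 2 ^ n)) +
          ((g (⌊s * 2 ^ n⌋₊ / 2 ^ n) - g s) - (g (⌊t * 2 ^ n⌋₊ / 2 ^ n) - g t)) := by ring
      have e2 : D * q ^ n = C * q ^ n + (C * q * q ^ n / (1 - q) + C * q * q ^ n / (1 - q)) := by
        rw [hD]; ring
      rw [e, e2]
      exact (abs_add_le _ _).trans (add_le_add h4 ((abs_sub _ _).trans (add_le_add h5 h6)))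
    refine h7.trans ?_
    rw [mul_assoc]
    refine mul_le_mul_of_nonneg_left ?_ hD0
    rw [hq, Real.rpow_pow_comm (by norm_num), ← Real.mul_rpow (by norm_num) (sub_pos.2 hst).le]
    refine Real.rpow_le_rpow (by positivity) ?_ hα.le
    rw [pow_succ] at hn1
    linarith
  refine ⟨D * 2 ^ α, fun s hs t ht => ?_⟩
  rcases lt_trichotomy s t with h | h | h
  · exact key s hs t ht h
  · rw [h, sub_self, abs_zero]
    positivity
  · rw [abs_sub_comm, abs_sub_comm t s]
    exact key t ht s hs h

theorem exists_holder_of_eventually_dyadic {g : ℝ → ℝ} {α : ℝ} (hg : Continuous g) (hα : 0 < α)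
    (h : ∀ᶠ n : ℕ in atTop, ∀ k : ℕ, k < 2 ^ n →
      |g ((k + 1 : ℕ) / 2 ^ n) - g (k / 2 ^ n)| ≤ ((1 / 2 : ℝ) ^ α) ^ n) :
    ∃ C', ∀ s ∈ Icc (0 : ℝ) 1, ∀ t ∈ Icc (0 : ℝ) 1, |g t - g s| ≤ C' * |t - s| ^ α := by
  obtain ⟨N, hN⟩ := eventually_atTop.1 h
  obtain ⟨M, hM⟩ := (isCompact_Icc (a := (0 : ℝ)) (b := 1)).exists_bound_of_continuousOn
    hg.continuousOn
  have hM0 : 0 ≤ M := (norm_nonneg _).trans (hM 0 ⟨le_rfl, zero_le_one⟩)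
  have hq1 : (1 / 2 : ℝ) ^ α < 1 := Real.rpow_lt_one (by norm_num) (by norm_num) hα
  set q : ℝ := (1 / 2 : ℝ) ^ α with hq
  have hq0 : 0 < q := by positivity
  -- The second summand absorbs the finitely many levels below `N`, where only `|g| ≤ M` is used.
  refine exists_holder_of_dyadic hg hα (C := 1 + 2 * M / q ^ N) (by positivity) fun n k hk => ?_
  rcases le_total N n with hn | hn
  · refine (hN n hn k hk).trans (le_mul_of_one_le_left (by positivity) ?_)
    have : 0 ≤ 2 * M / q ^ N := by positivity
    linarith
  · have hmem : ∀ j : ℕ, j ≤ 2 ^ n → (j : ℝ) / 2 ^ n ∈ Icc (0 : ℝ) 1 := fun j hj => by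
      refine ⟨by positivity, ?_⟩
      rw [div_le_one (by positivity)]
      exact_mod_cast hj
    have h1 := hM _ (hmem (k + 1) hk)
    have h2 := hM _ (hmem k hk.le)
    have h3 : 2 * M ≤ 2 * M / q ^ N * q ^ n := by
      rw [div_mul_eq_mul_div, le_div_iff₀ (by positivity)]
      exact mul_le_mul_of_nonneg_left (pow_le_pow_of_le_one hq0.le hq1.le hn) (by positivity)
    have h4 : 0 ≤ q ^ n := by positivity
    refine (abs_sub _ _).trans ?_
    rw [Real.norm_eq_abs] at h1 h2
    linarith

end Chaining

/-! ### Hölder regularity of Brownian paths. -/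

section Brownian

/-- Markov's inequality for the moment of order `2p`, which scales like `v^p`. -/
theorem exists_gaussianReal_tail_le (p : ℕ) : ∃ K : ℝ, 0 ≤ K ∧ ∀ (v : ℝ≥0) (l : ℝ), 0 < l →
    gaussianReal 0 v {x | l ≤ |x|} ≤ ENNReal.ofReal (K * v ^ p / l ^ (2 * p)) := by
  refine ⟨∫ x, x ^ (2 * p) ∂(gaussianReal 0 1),
    integral_nonneg fun x => Even.pow_nonneg (even_two_mul p) x, fun v l hl => ?_⟩
  have hmap : gaussianReal 0 v = (gaussianReal 0 1).map (√v * ·) := by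
    rw [gaussianReal_map_const_mul]
    congr 1
    · simp
    · ext; simp
  have hint : Integrable (fun x : ℝ => x ^ (2 * p)) (gaussianReal 0 v) := by
    have h := (memLp_id_gaussianReal (μ := 0) (v := v) (2 * p : ℕ)).integrable_norm_pow'
    simpa [Even.pow_abs (even_two_mul p)] using h
  have hmom : ∫ x, x ^ (2 * p) ∂(gaussianReal 0 v) =
      (∫ x, x ^ (2 * p) ∂(gaussianReal 0 1)) * v ^ p := by
    rw [hmap, integral_map (by fun_prop) (by fun_prop)]
    simp only [mul_pow]
    rw [integral_const_mul, pow_mul, Real.sq_sqrt v.coe_nonneg, mul_comm]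
  have hmark := mul_meas_ge_le_integral_of_nonneg
    (Eventually.of_forall fun x : ℝ => Even.pow_nonneg (even_two_mul p) x) hint (l ^ (2 * p))
  rw [← ofReal_measureReal]
  refine ENNReal.ofReal_le_ofReal ?_
  rw [le_div_iff₀ (by positivity), ← hmom, mul_comm]
  refine le_trans ?_ hmark
  refine mul_le_mul_of_nonneg_left (measureReal_mono fun x hx => ?_) (by positivity)
  simp only [mem_ofPred_eq] at hx ⊢
  rw [← Even.pow_abs (even_two_mul p) x]
  gcongr

variable {Ω : Type*} [MeasurableSpace Ω] {P : Measure Ω} {B : ℝ≥0 → Ω → ℝ}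

theorem ae_exists_holder_unit (hB : IsBrownianReal B P) {α : ℝ} (hα : 0 < α) (hα2 : α < 1 / 2) :
    ∀ᵐ ω ∂P, ∃ C, ∀ s ∈ Icc (0 : ℝ) 1, ∀ t ∈ Icc (0 : ℝ) 1,
      |B t.toNNReal ω - B s.toNNReal ω| ≤ C * |t - s| ^ α := by
  set q : ℝ := (1 / 2 : ℝ) ^ α with hq
  have hq0 : 0 < q := by positivity
  have hq2 : 1 < 2 * q ^ 2 := by
    rw [hq, ← Real.rpow_natCast, ← Real.rpow_mul (by norm_num)]
    have : (1 / 2 : ℝ) ^ (1 : ℝ) < (1 / 2 : ℝ) ^ (α * (2 : ℕ)) :=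
      Real.rpow_lt_rpow_of_exponent_gt (by norm_num) (by norm_num) (by push_cast; linarith)
    rw [Real.rpow_one] at this
    linarith
  -- The union bound over `2^n` intervals gives `K r^n` with `r = 2 (2q²)^(-p)`. Since `α < 1/2`
  -- means `2q² > 1`, a large moment makes this summable, and Borel–Cantelli applies.
  obtain ⟨p, hp⟩ := exists_pow_lt_of_lt_one (show (0 : ℝ) < 1 / 2 by norm_num)
    (show 1 / (2 * q ^ 2) < 1 from (div_lt_one (by positivity)).2 hq2)
  obtain ⟨K, hK0, hK⟩ := exists_gaussianReal_tail_le p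
  set r : ℝ := 2 * (1 / (2 * q ^ 2)) ^ p with hr
  have hr0 : 0 ≤ r := by positivity
  have hr1 : r < 1 := by linarith
  set S : ℕ → Set Ω := fun n => ⋃ k ∈ Finset.range (2 ^ n),
    {ω | q ^ n ≤ |B (((k + 1 : ℕ) : ℝ) / 2 ^ n).toNNReal ω - B ((k : ℝ) / 2 ^ n).toNNReal ω|}
    with hS
  have hPS : ∀ n, P (S n) ≤ ENNReal.ofReal (K * r ^ n) := fun n => by
    have hone : ∀ k ∈ Finset.range (2 ^ n), P {ω | q ^ n ≤
        |B (((k + 1 : ℕ) : ℝ) / 2 ^ n).toNNReal ω - B ((k : ℝ) / 2 ^ n).toNNReal ω|} ≤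
        ENNReal.ofReal (K * ((1 / 2) ^ n) ^ p / (q ^ n) ^ (2 * p)) := fun k _ => by
      have hlaw := hB.hasLaw_sub (((k + 1 : ℕ) : ℝ) / 2 ^ n).toNNReal ((k : ℝ) / 2 ^ n).toNNReal
      have hd : ((nndist (((k + 1 : ℕ) : ℝ) / 2 ^ n).toNNReal.1 ((k : ℝ) / 2 ^ n).toNNReal.1 : ℝ≥0)
          : ℝ) = (1 / 2) ^ n := by
        rw [coe_nndist, NNReal.val_eq_coe, NNReal.val_eq_coe, Real.coe_toNNReal _ (by positivity),
          Real.coe_toNNReal _ (by positivity), Real.dist_eq, ← sub_div]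
        push_cast
        rw [add_sub_cancel_left, abs_of_pos (by positivity), one_div_pow]
      have hms : MeasurableSet {x : ℝ | q ^ n ≤ |x|} :=
        measurableSet_le measurable_const (by fun_prop)
      have h := hK (nndist (((k + 1 : ℕ) : ℝ) / 2 ^ n).toNNReal.1 ((k : ℝ) / 2 ^ n).toNNReal.1)
        (q ^ n) (by positivity)
      rw [← hlaw.map_eq, Measure.map_apply_of_aemeasurable hlaw.aemeasurable hms, hd] at h
      exact h
    refine (measure_biUnion_finset_le _ _).trans ((Finset.sum_le_sum hone).trans_eq ?_)
    rw [Finset.sum_const, Finset.card_range, nsmul_eq_mul, ← ENNReal.ofReal_natCast,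
      ← ENNReal.ofReal_mul (by positivity)]
    congr 1
    rw [hr]
    push_cast
    simp only [mul_pow, div_pow, one_pow, ← pow_mul]
    rw [mul_comm p n, show n * (2 * p) = 2 * (n * p) by ring, show 2 * p * n = 2 * (n * p) by ring]
    field_simp
  have hsum : ∑' n, P (S n) ≠ ∞ := by
    refine ne_top_of_le_ne_top ?_ (ENNReal.tsum_le_tsum hPS)
    rw [← ENNReal.ofReal_tsum_of_nonneg (fun n => by positivity)
      ((summable_geometric_of_lt_one hr0 hr1).mul_left K)]
    exact ENNReal.ofReal_ne_top
  filter_upwards [hB.cont, ae_eventually_notMem hsum] with ω hc hω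
  refine exists_holder_of_eventually_dyadic (g := fun t => B t.toNNReal ω)
    (hc.comp continuous_real_toNNReal) hα ?_
  filter_upwards [hω] with n hn k hk
  simp only [hS, mem_iUnion, not_exists, Finset.mem_range] at hn
  exact (not_le.1 (hn k hk)).le

/-- Brownian scaling reduces `[0, R]` to the unit interval. -/
theorem ae_exists_holder (hB : IsBrownianReal B P) {α R : ℝ} (hα : 0 < α) (hα2 : α < 1 / 2)
    (hR : 0 < R) :
    ∀ᵐ ω ∂P, ∃ C, ∀ s ∈ Icc (0 : ℝ) R, ∀ t ∈ Icc (0 : ℝ) R,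
      |B t.toNNReal ω - B s.toNNReal ω| ≤ C * |t - s| ^ α := by
  have hR' : R.toNNReal ≠ 0 := (Real.toNNReal_pos.2 hR).ne'
  filter_upwards [ae_exists_holder_unit (hB.smul hR') hα hα2] with ω hω
  obtain ⟨C, hC⟩ := hω
  refine ⟨√R * (C * (R ^ α)⁻¹), fun s hs t ht => ?_⟩
  have hmem : ∀ x ∈ Icc (0 : ℝ) R, x / R ∈ Icc (0 : ℝ) 1 := fun x hx =>
    ⟨div_nonneg hx.1 hR.le, (div_le_one hR).2 hx.2⟩
  have heq : ∀ x : ℝ, R.toNNReal * (x / R).toNNReal = x.toNNReal := fun x => by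
    rw [← Real.toNNReal_mul hR.le, mul_div_cancel₀ _ hR.ne']
  have h := hC _ (hmem s hs) _ (hmem t ht)
  rw [heq, heq, Real.coe_toNNReal _ hR.le, ← mul_sub, abs_mul, abs_inv,
    abs_of_pos (Real.sqrt_pos.2 hR), inv_mul_le_iff₀ (Real.sqrt_pos.2 hR), ← sub_div, abs_div,
    abs_of_pos hR, Real.div_rpow (abs_nonneg _) hR.le] at h
  refine h.trans_eq ?_
  ring

end Brownian

/-! ### Gluing two paths at the origin. -/

section TwoSided

variable {b b' : ℝ≥0 → ℝ}

theorem twoSided_of_nonneg {t : ℝ} (ht : 0 ≤ t) : twoSided b b' t = b t.toNNReal := if_pos ht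

theorem twoSided_of_nonpos (h0 : b 0 = b' 0) {t : ℝ} (ht : t ≤ 0) :
    twoSided b b' t = b' (-t).toNNReal := by
  rcases ht.lt_or_eq with h | rfl
  · exact if_neg (not_le.2 h)
  · simp [twoSided, h0]

theorem continuous_twoSided (hb : Continuous b) (hb' : Continuous b') (h0 : b 0 = b' 0) :
    Continuous (twoSided b b') := by
  unfold twoSided
  refine Continuous.if_le (by fun_prop) (by fun_prop) continuous_const continuous_id ?_
  rintro x rfl
  simpa using h0

/-- For points on opposite sides, pass through `0`: both pieces are no longer than `|x - y|`, so the
constants add. -/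
theorem twoSided_holder (h0 : b 0 = b' 0) {R α C C' : ℝ} (hα : 0 ≤ α)
    (hC : ∀ s ∈ Icc (0 : ℝ) R, ∀ t ∈ Icc (0 : ℝ) R,
      |b t.toNNReal - b s.toNNReal| ≤ C * |t - s| ^ α)
    (hC' : ∀ s ∈ Icc (0 : ℝ) R, ∀ t ∈ Icc (0 : ℝ) R,
      |b' t.toNNReal - b' s.toNNReal| ≤ C' * |t - s| ^ α) :
    ∀ x ∈ Icc (-R) R, ∀ y ∈ Icc (-R) R,
      |twoSided b b' x - twoSided b b' y| ≤ (|C| + |C'|) * |x - y| ^ α := by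
  have key : ∀ x ∈ Icc (-R) R, ∀ y ∈ Icc (-R) R, y ≤ x →
      |twoSided b b' x - twoSided b b' y| ≤ (|C| + |C'|) * |x - y| ^ α := by
    intro x hx y hy hyx
    have hp : 0 ≤ |x - y| ^ α := by positivity
    have hc : C * |x - y| ^ α ≤ |C| * |x - y| ^ α := by gcongr; exact le_abs_self C
    have hc' : C' * |x - y| ^ α ≤ |C'| * |x - y| ^ α := by gcongr; exact le_abs_self C'
    have e1 : 0 ≤ |C| * |x - y| ^ α := by positivity
    have e2 : 0 ≤ |C'| * |x - y| ^ α := by positivity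
    rcases le_total 0 y with h1 | h1
    · rw [twoSided_of_nonneg h1, twoSided_of_nonneg (h1.trans hyx)]
      have := hC y ⟨h1, hy.2⟩ x ⟨h1.trans hyx, hx.2⟩
      linarith
    rcases le_total x 0 with h2 | h2
    · rw [twoSided_of_nonpos h0 h1, twoSided_of_nonpos h0 h2]
      have := hC' (-y) ⟨by linarith, by linarith [hy.1]⟩ (-x) ⟨by linarith, by linarith [hx.1]⟩
      rw [show -x - -y = -(x - y) by ring, abs_neg] at this
      linarith
    · rw [twoSided_of_nonneg h2, twoSided_of_nonpos h0 h1]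
      have hR : 0 ≤ R := h2.trans hx.2
      have t1 := hC 0 ⟨le_rfl, hR⟩ x ⟨h2, hx.2⟩
      have t2 := hC' 0 ⟨le_rfl, hR⟩ (-y) ⟨by linarith, by linarith [hy.1]⟩
      rw [Real.toNNReal_zero, sub_zero] at t1 t2
      have m1 : |x| ^ α ≤ |x - y| ^ α := by
        gcongr 1
        rw [abs_of_nonneg h2]
        exact (by linarith : x ≤ x - y).trans (le_abs_self _)
      have m2 : |-y| ^ α ≤ |x - y| ^ α := by
        gcongr 1
        rw [abs_of_nonneg (by linarith)]
        exact (by linarith : -y ≤ x - y).trans (le_abs_self _)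
      have t1' : C * |x| ^ α ≤ |C| * |x - y| ^ α := by
        gcongr
        exact le_abs_self C
      have t2' : C' * |-y| ^ α ≤ |C'| * |x - y| ^ α := by
        gcongr
        exact le_abs_self C'
      rw [show b x.toNNReal - b' (-y).toNNReal =
        (b x.toNNReal - b 0) - (b' (-y).toNNReal - b' 0) by rw [h0]; ring]
      refine (abs_sub _ _).trans ?_
      linarith
  intro x hx y hy
  rcases le_total y x with h | h
  · exact key x hx y hy h
  · rw [abs_sub_comm, abs_sub_comm x y]
    exact key y hy x hx h

end TwoSided

end AllenCahn

theorem mainTheorem3 {Ω : Type*} [MeasurableSpace Ω] (P : Measure Ω) [IsProbabilityMeasure P]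
    (B B' : ℝ≥0 → Ω → ℝ) (hB : IsBrownianReal B P) (hB' : IsBrownianReal B' P)
    (hindep : IndepFun (fun ω t => B t ω) (fun ω t => B' t ω) P)
    (W : ℝ → Ω → ℝ)
    (hW : ∀ t ω, W t ω = AllenCahn.twoSided (fun s => B s ω) (fun s => B' s ω) t)
    (ρ : ℝ → ℝ) (hρ : AllenCahn.IsMollifier ρ)
    (γ : ℝ) (hγ₀ : 0 < γ) (hγ : γ < 2 / 3)
    (β : ℝ) (hβ₁ : 1 < β) (hβ₂ : β < 2)
    (T : ℝ) (hT : 0 < T) :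
    ∀ᵐ ω ∂P, ∀ σ : ℝ, σ = 1 ∨ σ = -1 →
      (∀ᶠ ε in 𝓝[>] (0 : ℝ),
        (∀ s ∈ Icc 0 T,
          DifferentiableAt ℝ (AllenCahn.mollified ρ γ (fun r => W r ω) ε) s ∧
          AllenCahn.HasWaveSpeed (AllenCahn.forcing ρ γ β σ (fun r => W r ω) ε s)) ∧
        IntervalIntegrable
          (fun s => ε⁻¹ * AllenCahn.waveSpeed (AllenCahn.forcing ρ γ β σ (fun r => W r ω) ε s))
          volume 0 T) ∧
      ∀ α : ℝ≥0, α < 1 / 2 →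
        AllenCahn.TendstoHolder T α
          (fun ε t => AllenCahn.c₀ * AllenCahn.Wpm ρ γ β σ (fun r => W r ω) ε t)
          (fun t => -(AllenCahn.c₀ * W t ω)) := by
  -- Countably many exponents increasing to `1/2` give one null set valid for all `α`; the shift by
  -- 3 keeps them positive. The length `T + 1` leaves room for the mollifier.
  have hholder : ∀ᵐ ω ∂P, ∀ n : ℕ,
      (∃ C, ∀ s ∈ Icc (0 : ℝ) (T + 1), ∀ t ∈ Icc (0 : ℝ) (T + 1),
        |B t.toNNReal ω - B s.toNNReal ω| ≤ C * |t - s| ^ (1 / 2 - 1 / ((n : ℝ) + 3))) ∧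
      (∃ C, ∀ s ∈ Icc (0 : ℝ) (T + 1), ∀ t ∈ Icc (0 : ℝ) (T + 1),
        |B' t.toNNReal ω - B' s.toNNReal ω| ≤ C * |t - s| ^ (1 / 2 - 1 / ((n : ℝ) + 3))) := by
    refine ae_all_iff.2 fun n => ?_
    have h1 : (0 : ℝ) < 1 / 2 - 1 / ((n : ℝ) + 3) := by
      rw [sub_pos]
      exact one_div_lt_one_div_of_lt (by norm_num) (by linarith [n.cast_nonneg (α := ℝ)])
    have h2 : 1 / 2 - 1 / ((n : ℝ) + 3) < 1 / 2 := sub_lt_self _ (by positivity)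
    exact (AllenCahn.ae_exists_holder hB h1 h2 (by linarith)).and
      (AllenCahn.ae_exists_holder hB' h1 h2 (by linarith))
  filter_upwards [hB.cont, hB'.cont, hB.eval_zero_ae_eq_zero, hB'.eval_zero_ae_eq_zero, hholder]
    with ω hc hc' h0 h0' hH σ hσ
  have hσ1 : |σ| ≤ 1 := by rcases hσ with rfl | rfl <;> simp
  have hb0 : B 0 ω = B' 0 ω := by rw [h0, h0']
  have hWω : (fun r => W r ω) = AllenCahn.twoSided (fun s => B s ω) (fun s => B' s ω) :=
    funext fun t => hW t ω
  have hw : Continuous fun r => W r ω := hWω ▸ AllenCahn.continuous_twoSided hc hc' hb0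
  have hw0 : W 0 ω = 0 := by
    rw [hW, AllenCahn.twoSided_of_nonneg le_rfl, Real.toNNReal_zero, h0]
  refine ⟨?_, fun α hα => ?_⟩
  · filter_upwards [AllenCahn.eventually_abs_forcing_le (T := T) hρ hw hγ₀ hγ hβ₁ hσ1,
      self_mem_nhdsWithin] with ε hF hε
    refine ⟨fun s hs => ⟨(AllenCahn.hasDerivAt_mollified hρ hw hε s).differentiableAt,
      AllenCahn.hasWaveSpeed_of_abs_le (hF s hs)⟩, ?_⟩
    refine ContinuousOn.intervalIntegrable ?_
    rw [uIcc_of_le hT.le]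
    exact AllenCahn.continuousOn_waveSpeed_forcing hρ hw hε hF
  · have hα' : (α : ℝ) < 1 / 2 := by exact_mod_cast hα
    obtain ⟨n, hn⟩ := exists_nat_one_div_lt (sub_pos.2 hα')
    obtain ⟨⟨C, hC⟩, ⟨C', hC'⟩⟩ := hH n
    have h3 : 1 / ((n : ℝ) + 3) ≤ 1 / ((n : ℝ) + 1) := by gcongr; norm_num
    have h4 : 0 < 1 / ((n : ℝ) + 3) := by positivity
    have hαn : (α : ℝ) < 1 / 2 - 1 / ((n : ℝ) + 3) := by linarith
    have hhol := AllenCahn.twoSided_holder (b := fun s => B s ω)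
      (b' := fun s => B' s ω) hb0 (α.coe_nonneg.trans hαn.le) hC hC'
    rw [← hWω] at hhol
    exact AllenCahn.tendstoHolder_Wpm hρ hw hw0 hγ₀ hγ hβ₁ hσ1 hT hαn (by linarith)
      fun x hx y hy => hhol x ⟨by linarith [hx.1], hx.2⟩ y ⟨by linarith [hy.1], hy.2⟩
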